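/- Let $\nu$ be a lattice path starting at $(0,0)$ with finitely many north and east steps. Let $F_\nu$ be the Ferrers diagram weakly above $\nu$ inside the smallest rectangle containing $\nu$, let $A_\nu$ be the set of lattice points of this rectangle that are weakly above $\nu$, and for $p\in A_\nu$ let $d(p)$ be the lattice distance from $p$ to the top-left corner of $F_\nu$. Points $p,q\in A_\nu$ are $\nu$-incompatible if one of them is strictly southwest of the other and the smallest rectangle containing $p$ and $q$ lies in $F_\nu$; otherwise they are $\nu$-compatible. A $\nu$-tree is a maximal set of pairwise $\nu$-compatible elements of $A_\nu$; its elements are called nodes. A node $q$ of a $\nu$-tree $T$ is an ascent if $T$ has a node to the north of $q$ (same column, above $q$) and a node to the east of $q$ (same row, to the right of $q$). Let $n$ be such that $d(p)+1\le n$ for all $p\in A_\nu$. Let $s_1,\dots,s_n$ be the simple transpositions $s_k=(k,k+1)$ of $\mathcal S_{n+1}$, which acts on $\mathbb R^{n+1}$ by permuting coordinates ($w\,e_i=e_{w(i)}$), and let $\alpha_k=e_k-e_{k+1}$. Let $p_1,\dots,p_m$ be the points of $A_\nu$, read from bottom to top within each column, and the columns from left to right, and let $Q_\nu=(q_1,\dots,q_m)$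 be the word with $q_k=s_{d(p_k)+1}$. For a $\nu$-tree $T$ and a node $t=p_k\in T$, define the root $$\beta_t:=r(T,t):=\Big(\prod_{j<k,\ p_j\notin T} q_j\Big)\big(\alpha_{d(p_k)+1}\big),$$ where the product is taken in the order of the word. Let $V=\{x\in\mathbb R^{n+1}\mid x_1+\dots+x_{n+1}=0\}$. **Lemma.** Let $T$ be a $\nu$-tree and let $A\subseteq T$ be a set of ascents of $T$. Then there is a linear functional $f$ on $\mathbb R^{n+1}$ such that $$f(\beta_a)=0\ \text{ for all } a\in A\qquad\text{and}\qquad f(\beta_t)>0\ \text{ for all } t\in T\setminus A.$$ Equivalently, the marked cone $$C(T_A)=\{x\in V\mid \langle x,\beta_t\rangle>0\text{ for all }t\in T\setminus A,\ \langle x,\beta_a\rangle=0\text{ for all }a\in A\}$$ is nonempty. -/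

import Mathlib

namespace NuTamari

/-! ### Type `A` root systems and the root function -/

/-- The simple transposition exchanging `p` and `p + 1` in the symmetric group on `n + 1` letters
(zero-based: `Fin (n + 1) = {0, …, n}` and `p ∈ {0, …, n - 1}`). -/
def simpleTransposition {n : ℕ} (p : Fin n) : Equiv.Perm (Fin (n + 1)) :=
  Equiv.swap p.castSucc p.succ

/-- The simple root `e_p - e_{p+1}` in `ℝ^{n+1}`. -/
def simpleRoot {n : ℕ} (p : Fin n) : Fin (n + 1) → ℝ :=
  Pi.single p.castSucc 1 - Pi.single p.succ 1

/-- The action of a permutation on `ℝ^{n+1}` by permuting coordinates, `w (e_i) = e_{w i}`. -/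
def permAct {n : ℕ} (w : Equiv.Perm (Fin (n + 1))) (x : Fin (n + 1) → ℝ) : Fin (n + 1) → ℝ :=
  fun i => x (w⁻¹ i)

/-- The space `{x ∈ ℝ^{n+1} | x_1 + ⋯ + x_{n+1} = 0}` on which the symmetric group acts. -/
def coxeterSpace (n : ℕ) : Submodule ℝ (Fin (n + 1) → ℝ) where
  carrier := {x | ∑ i, x i = 0}
  add_mem' := by
    intro a b ha hb
    simp only [Set.mem_ofPred_eq] at *
    simp [Finset.sum_add_distrib, ha, hb]
  zero_mem' := by simp
  smul_mem' := by
    intro c x hx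
    simp only [Set.mem_ofPred_eq] at *
    simp [← Finset.mul_sum, hx]

/-- The root function: for a word `Q = (q_1, …, q_m)` in the simple transpositions and a set `I` of
positions, `r(I, k)` is the image of the simple root `α_{q_k}` under the product, in the order of
the word, of the letters at the positions `< k` that are not in `I`. -/
def rootFunction {m n : ℕ} (Q : Fin m → Fin n) (I : Finset (Fin m)) (k : Fin m) :
    Fin (n + 1) → ℝ :=
  permAct
    (((List.finRange m).filter (fun j => j < k ∧ j ∉ I)).map
      (fun j => simpleTransposition (Q j))).prod
    (simpleRoot (Q k))

/-! ### Lattice paths, `ν`-trees and ascents -/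

/-- A north step or an east step. -/
inductive PathStep where
  | north : PathStep
  | east : PathStep

/-- A lattice path with finitely many north and east steps; it starts at `(0, 0)`. -/
abbrev LatticePath := List PathStep

/-- The number of east steps of a path. -/
def width : LatticePath → ℕ
  | [] => 0
  | PathStep.north :: ν => width ν
  | PathStep.east :: ν => width ν + 1

/-- The number of north steps of a path. -/
def height : LatticePath → ℕ
  | [] => 0
  | PathStep.north :: ν => height ν + 1
  | PathStep.east :: ν => height ν

/-- The list of lattice points visited by a path that starts at the given point. -/
def visitedFrom : ℕ × ℕ → LatticePath → List (ℕ × ℕ)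
  | p, [] => [p]
  | p, PathStep.north :: ν => p :: visitedFrom (p.1, p.2 + 1) ν
  | p, PathStep.east :: ν => p :: visitedFrom (p.1 + 1, p.2) ν

/-- A point `(x, y)` is weakly above `ν` if `ν` visits a point `(x, y')` with `y' ≤ y`. -/
def WeaklyAbove (ν : LatticePath) (p : ℕ × ℕ) : Prop :=
  ∃ v ∈ visitedFrom (0, 0) ν, v.1 = p.1 ∧ v.2 ≤ p.2

instance (ν : LatticePath) : DecidablePred (WeaklyAbove ν) :=
  fun p => inferInstanceAs (Decidable (∃ v ∈ visitedFrom (0, 0) ν, v.1 = p.1 ∧ v.2 ≤ p.2))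

/-- The points of `A_ν`, that is, the lattice points weakly above `ν` in the smallest rectangle
containing `ν`, listed from bottom to top within a column, and the columns from left to right. -/
def readingOrder (ν : LatticePath) : List (ℕ × ℕ) :=
  (List.product (List.range (width ν + 1)) (List.range (height ν + 1))).filter
    (fun p => WeaklyAbove ν p)

/-- The set `A_ν` of lattice points weakly above `ν` in the smallest rectangle containing `ν`. -/
abbrev Pt (ν : LatticePath) : Type := {p : ℕ × ℕ // p ∈ readingOrder ν}

/-- A pair of integers is a point of `A_ν` iff it lies in the bounding rectangle of `ν`, weakly
above `ν`. -/
theorem mem_readingOrder (ν : LatticePath) (p : ℕ × ℕ) :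
    p ∈ readingOrder ν ↔ p.1 ≤ width ν ∧ p.2 ≤ height ν ∧ WeaklyAbove ν p := by
  obtain ⟨x, y⟩ := p
  simp only [readingOrder, List.mem_filter, List.pair_mem_product, List.mem_range,
    decide_eq_true_eq, Nat.lt_succ_iff, and_assoc]

/-- `p` is strictly southwest of `q`. -/
def SouthWest (p q : ℕ × ℕ) : Prop := p.1 < q.1 ∧ p.2 < q.2

/-- `p` and `q` are `ν`-incompatible: one of them is southwest of the other, and the smallest
rectangle containing them lies inside the Ferrers diagram `F_ν`. As one point is strictly southwest
of the other, this containment says that all lattice points of the rectangle belong to `A_ν`. -/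
def Incompatible {ν : LatticePath} (p q : Pt ν) : Prop :=
  (SouthWest p.1 q.1 ∧ ∀ r, p.1 ≤ r → r ≤ q.1 → r ∈ readingOrder ν) ∨
  (SouthWest q.1 p.1 ∧ ∀ r, q.1 ≤ r → r ≤ p.1 → r ∈ readingOrder ν)

/-- A `ν`-tree is a maximal collection of pairwise `ν`-compatible elements of `A_ν`. -/
def IsNuTree {ν : LatticePath} (T : Finset (Pt ν)) : Prop :=
  Maximal (fun S : Finset (Pt ν) => ∀ p ∈ S, ∀ q ∈ S, ¬ Incompatible p q) T

/-- A node `q` of `T` is an ascent if `T` has a node to the north of `q` (same column, above)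
and a node to the east of `q` (same row, to the right). -/
def IsAscent {ν : LatticePath} (T : Finset (Pt ν)) (q : Pt ν) : Prop :=
  q ∈ T ∧ (∃ p ∈ T, p.1.1 = q.1.1 ∧ q.1.2 < p.1.2) ∧ (∃ r ∈ T, r.1.2 = q.1.2 ∧ q.1.1 < r.1.1)

/-! ### The word `Q_ν` and the roots of a `ν`-tree -/

/-- The lattice distance of `p` to the top-left corner `(0, height ν)` of the Ferrers diagram. -/
def dist {ν : LatticePath} (p : Pt ν) : ℕ := p.1.1 + (height ν - p.1.2)

/-- The point of `A_ν` at a given position of the reading order. -/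
def pointAt {ν : LatticePath} (k : Fin (readingOrder ν).length) : Pt ν :=
  ⟨(readingOrder ν).get k, List.get_mem _ k⟩

/-- The position of a point of `A_ν` in the reading order. -/
def position {ν : LatticePath} (p : Pt ν) : Fin (readingOrder ν).length :=
  ⟨(readingOrder ν).idxOf p.1, List.idxOf_lt_length_iff.2 p.2⟩

/-- The point at the position of `p` is `p`. -/
theorem pointAt_position {ν : LatticePath} (p : Pt ν) : pointAt (position p) = p := by
  apply Subtype.ext
  simp [pointAt, position]

/-- The word `Q_ν`: the letter at the position of `p` is the simple transposition `s_{d(p)+1}`.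
In zero-based indexing this is the letter `d(p)`. The hypothesis says that all these letters belong
to the symmetric group on `n + 1` letters. -/
def word (ν : LatticePath) (n : ℕ) (hn : ∀ p : Pt ν, dist p < n) :
    Fin (readingOrder ν).length → Fin n :=
  fun k => ⟨dist (pointAt k), hn (pointAt k)⟩

/-- The set of positions in `Q_ν` of the nodes in `T`. -/
def positions {ν : LatticePath} (T : Finset (Pt ν)) : Finset (Fin (readingOrder ν).length) :=
  Finset.univ.filter (fun k => pointAt k ∈ T)

/-- The root `β_t = r(T, t)`. -/
def nodeRoot {ν : LatticePath} (n : ℕ) (hn : ∀ p : Pt ν, dist p < n) (T : Finset (Pt ν))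
    (t : Pt ν) : Fin (n + 1) → ℝ :=
  rootFunction (word ν n hn) (positions T) (position t)

/-- The marked cone `C(T_M)`: the vectors `x` of coordinate sum zero with `⟨x, β_t⟩ > 0` for all
`t ∈ T ∖ M` and `⟨x, β_t⟩ = 0` for all `t ∈ M`. -/
def markedCone {ν : LatticePath} (n : ℕ) (hn : ∀ p : Pt ν, dist p < n) (T M : Finset (Pt ν)) :
    Set (Fin (n + 1) → ℝ) :=
  {x | x ∈ coxeterSpace n ∧ (∀ t ∈ T \ M, 0 < x ⬝ᵥ nodeRoot n hn T t) ∧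
    ∀ t ∈ M, x ⬝ᵥ nodeRoot n hn T t = 0}

end NuTamari

namespace NuTamari

open Equiv

/-! Put an elbow at every node of `T` and a crossing at every other point of the diagram. The
letters read before `t` record which pipe runs at which level, so `β_t = e_l - e_b`, where `l` and
`b` are the pipes entering `t` from the left and from below (`dotProduct_nodeRoot`). What is needed
is a real value for each pipe, equal on both pipes at contacts in `A`, and larger on the left pipe
at all other contacts (`exists_pipe_potential`).

Values are assigned in reading order, to each pipe when it is first touched. The invariant
`SweepState.order` says that on live touched pipes the value strictly decreases with the level,
except that a pipe may tie with one of smaller level while a node lies ahead in its row.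

Compatibility provides the freedom. If a node lies above a tile in its column, no node lies west of
the tile in its row, since the tile would be the corner of a forbidden rectangle; hence the left
pipe is still untouched. At an ascent it can therefore copy the value of the bottom pipe, and the
node to the east makes this tie admissible. At any other node, a touched left pipe already exceeds
the bottom one, because a vertical pipe is never waiting, and an untouched one receives a value in
an open gap. -/

/-! ### Pipes of a compatible filling -/

/-- A set `F` of lattice points of height at most `H` closed under moving west and north, together
with a subset `T` without incompatible pairs. -/
structure CompatibleFilling (H : ℕ) (F T : Set (ℕ × ℕ)) : Prop where
  closed : ∀ {x y x' y' : ℕ}, (x, y) ∈ F → x' ≤ x → y ≤ y' → y' ≤ H → (x', y') ∈ F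
  le_height : ∀ {x y : ℕ}, (x, y) ∈ F → y ≤ H
  subset : ∀ {x y : ℕ}, (x, y) ∈ T → (x, y) ∈ F
  compatible : ∀ {x₁ y₁ x₂ y₂ : ℕ}, (x₁, y₁) ∈ T → (x₂, y₂) ∈ T → x₁ < x₂ → y₁ < y₂ →
    (x₂, y₁) ∉ F

open Classical in
/-- The adjacent transposition at a crossing tile, and the identity at all other tiles. -/
noncomputable def tilePerm (H : ℕ) (F T : Set (ℕ × ℕ)) (p : ℕ × ℕ) : Perm ℕ :=
  if p ∈ F ∧ p ∉ T then swap (p.1 + (H - p.2)) (p.1 + (H - p.2) + 1) else 1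

/-- The product of the tiles that precede `(c, y)` in the reading order. At this stage the pipe
at level `l` is the image of `l`. -/
noncomputable def sweepPerm (H : ℕ) (F T : Set (ℕ × ℕ)) (c y : ℕ) : Perm ℕ :=
  ((List.range c).map
    (fun x => ((List.range (H + 1)).map (fun z => tilePerm H F T (x, z))).prod)).prod *
    ((List.range y).map (fun z => tilePerm H F T (c, z))).prod

section Sweep

variable {H : ℕ} {F T M : Set (ℕ × ℕ)}

theorem sweepPerm_succ (c y : ℕ) :
    sweepPerm H F T c (y + 1) = sweepPerm H F T c y * tilePerm H F T (c, y) := by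
  simp [sweepPerm, List.range_succ, mul_assoc]

theorem sweepPerm_next_column (c : ℕ) :
    sweepPerm H F T (c + 1) 0 = sweepPerm H F T c (H + 1) := by
  simp [sweepPerm, List.range_succ]

/-- The pipe that enters the tile at `p` from the left. -/
noncomputable def leftPipe (H : ℕ) (F T : Set (ℕ × ℕ)) (p : ℕ × ℕ) : ℕ :=
  sweepPerm H F T p.1 p.2 (p.1 + (H - p.2))

/-- The pipe that enters the tile at `p` from below. -/
noncomputable def bottomPipe (H : ℕ) (F T : Set (ℕ × ℕ)) (p : ℕ × ℕ) : ℕ :=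
  sweepPerm H F T p.1 p.2 (p.1 + (H - p.2) + 1)

/-! ### The sweep invariant -/

/-- Before the tile `(c, y)` is read, the pipe at level `l` may still turn at a node or leave the
diagram to the right. -/
def Live (H : ℕ) (F T : Set (ℕ × ℕ)) (c y l : ℕ) : Prop :=
  c ≤ l ∧ (l + y = c + H + 1 → (y ≤ H ∧ (c, y) ∉ F) ∨ ∃ z, y ≤ z ∧ (c, z) ∈ T)

/-- Before the tile `(c, y)` is read, the pipe at level `l` runs in a row with a node ahead. -/
def Waiting (H : ℕ) (T : Set (ℕ × ℕ)) (c y l : ℕ) : Prop :=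
  ∃ u z, (u, z) ∈ T ∧ ((l + z = c + H ∧ y ≤ z ∧ c ≤ u) ∨ (l + z = c + 1 + H ∧ z < y ∧ c < u))

/-- The invariant of the sweep before the tile `(c, y)` is read: `f` is a potential for the
contacts seen so far, and `S` is the set of pipes which took part in them. -/
structure SweepState (H : ℕ) (F T M : Set (ℕ × ℕ)) (c y : ℕ) (f : ℕ → ℝ) (S : Finset ℕ) :
    Prop where
  contact : ∀ x z, (x, z) ∈ T → (x < c ∨ x = c ∧ z < y) →
    leftPipe H F T (x, z) ∈ S ∧ bottomPipe H F T (x, z) ∈ S ∧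
    ((x, z) ∈ M → f (leftPipe H F T (x, z)) = f (bottomPipe H F T (x, z))) ∧
    ((x, z) ∉ M → f (bottomPipe H F T (x, z)) < f (leftPipe H F T (x, z)))
  -- With no node to the west in its row, a pipe has crossed straight from the left border and met
  -- no contact.
  fresh_ahead : ∀ z l, y ≤ z → l + z = c + H → (c, z) ∈ F → (∀ u < c, (u, z) ∉ T) →
    sweepPerm H F T c y l ∉ S
  fresh_passed : ∀ z l, z < y → l + z = c + 1 + H → (c, z) ∈ F → (∀ u ≤ c, (u, z) ∉ T) →
    sweepPerm H F T c y l ∉ S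
  vertical : ∀ z l, z < y → (c, z) ∈ T → l + y = c + H + 1 → sweepPerm H F T c y l ∈ S
  -- Ties are harmless at contacts: the pipe of larger level there is the bottom one, which is
  -- vertical and hence not waiting.
  order : ∀ l₁ l₂, l₁ < l₂ → Live H F T c y l₁ → Live H F T c y l₂ →
    sweepPerm H F T c y l₁ ∈ S → sweepPerm H F T c y l₂ ∈ S →
    f (sweepPerm H F T c y l₂) < f (sweepPerm H F T c y l₁) ∨
    f (sweepPerm H F T c y l₂) = f (sweepPerm H F T c y l₁) ∧ Waiting H T c y l₂

theorem SweepState.initial (f : ℕ → ℝ) : SweepState H F T M 0 0 f ∅ where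
  contact := by intro x z _ h; omega
  fresh_ahead := by simp
  fresh_passed := by simp
  vertical := by intro z l h; omega
  order := by simp

/-! ### Preservation of the invariant, tile by tile -/

theorem SweepState.next_column (hF : CompatibleFilling H F T) {c : ℕ} {f : ℕ → ℝ} {S : Finset ℕ}
    (h : SweepState H F T M c (H + 1) f S) : SweepState H F T M (c + 1) 0 f S where
  contact x z hT hx := h.contact x z hT (by
    have := hF.le_height (hF.subset hT); omega)
  fresh_ahead z l _ hl hz hu := by
    rw [sweepPerm_next_column]
    have hzH := hF.le_height hz
    exact h.fresh_passed z l (by omega) (by omega) (hF.closed hz (by omega) le_rfl hzH)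
      (fun u hu' => hu u (by omega))
  fresh_passed z l hz := by omega
  vertical z l hz := by omega
  order l₁ l₂ hl h₁ h₂ := by
    -- Level `c` carries the pipe leaving through the top of column `c`. It is no longer live, so
    -- the vertical clause is vacuous.
    have live : ∀ l, Live H F T (c + 1) 0 l → Live H F T c (H + 1) l := by
      intro l hl
      have := hl.1
      exact ⟨by omega, fun h => by omega⟩
    rw [sweepPerm_next_column]
    intro hS₁ hS₂
    refine (h.order l₁ l₂ hl (live _ h₁) (live _ h₂) hS₁ hS₂).imp_right fun h => ⟨h.1, ?_⟩
    obtain ⟨u, z, hT, h⟩ := h.2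
    have := hF.le_height (hF.subset hT)
    exact ⟨u, z, hT, Or.inl (by omega)⟩

/-- Levels are not exchanged outside `F`: the pipe below an empty tile turns right and stays in
play. The first alternative in `Live` accounts for it. -/
theorem SweepState.empty_tile (hF : CompatibleFilling H F T) {c y : ℕ} {f : ℕ → ℝ} {S : Finset ℕ}
    (h : SweepState H F T M c y f S) (hy : y ≤ H) (hcy : (c, y) ∉ F) :
    SweepState H F T M c (y + 1) f S := by
  have hw : sweepPerm H F T c (y + 1) = sweepPerm H F T c y := by
    simp [sweepPerm_succ, tilePerm, hcy]
  have hT : ∀ u, c ≤ u → (u, y) ∉ T := fun u hu hT =>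
    hcy (hF.closed (hF.subset hT) hu le_rfl hy)
  have hlow : ∀ z, z ≤ y → (c, z) ∉ F := fun z hz hzF => hcy (hF.closed hzF le_rfl hz hy)
  have live : ∀ l, Live H F T c (y + 1) l → Live H F T c y l := fun l hl =>
    ⟨hl.1, fun _ => Or.inl ⟨hy, hcy⟩⟩
  constructor
  · intro x z hxz hlt
    refine h.contact x z hxz ?_
    rcases hlt with hlt | ⟨rfl, hlt⟩
    · exact Or.inl hlt
    · exact absurd (hF.subset hxz) (hlow z (by omega))
  · intro z l hz hl hzF hu
    rw [hw]
    exact h.fresh_ahead z l (by omega) hl hzF hu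
  · intro z l hz _ hzF
    exact absurd hzF (hlow z (by omega))
  · intro z l hz hzT
    exact absurd (hF.subset hzT) (hlow z (by omega))
  · intro l₁ l₂ hl h₁ h₂ hS₁ hS₂
    rw [hw] at hS₁ hS₂ ⊢
    refine (h.order l₁ l₂ hl (live _ h₁) (live _ h₂) hS₁ hS₂).imp_right fun h => ⟨h.1, ?_⟩
    obtain ⟨u, z, huT, hz⟩ := h.2
    have hzy : z ≠ y ∨ u < c := by
      by_contra! hcon
      exact hT u hcon.2 (hcon.1 ▸ huT)
    exact ⟨u, z, huT, by omega⟩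

/-- Only the two crossing pipes change their relative order. If the one going up remains live, the
column has a node above, so the other one is untouched and the pair imposes no condition. -/
theorem SweepState.crossing_tile (hF : CompatibleFilling H F T) {c y : ℕ} {f : ℕ → ℝ}
    {S : Finset ℕ} (h : SweepState H F T M c y f S) (hcy : (c, y) ∈ F) (hcyT : (c, y) ∉ T) :
    SweepState H F T M c (y + 1) f S := by
  have hy := hF.le_height hcy
  obtain ⟨d, hd⟩ : ∃ d, d = c + (H - y) := ⟨_, rfl⟩
  have hw : ∀ l, sweepPerm H F T c (y + 1) l = sweepPerm H F T c y (swap d (d + 1) l) := by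
    intro l
    simp [sweepPerm_succ, tilePerm, hcy, hcyT, hd]
  have hwd : sweepPerm H F T c (y + 1) d = sweepPerm H F T c y (d + 1) := by simp [hw]
  have hwd' : sweepPerm H F T c (y + 1) (d + 1) = sweepPerm H F T c y d := by simp [hw]
  have hwo : ∀ l, l ≠ d → l ≠ d + 1 → sweepPerm H F T c (y + 1) l = sweepPerm H F T c y l := by
    intro l h₁ h₂
    rw [hw, swap_apply_of_ne_of_ne h₁ h₂]
  have hrow : ∀ z, y < z → (c, z) ∈ T → sweepPerm H F T c y d ∉ S := by
    intro z hz hzT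
    refine h.fresh_ahead y d le_rfl (by omega) hcy fun u hu huT => ?_
    exact hF.compatible huT hzT hu hz hcy
  constructor
  · intro x z hxz hlt
    refine h.contact x z hxz ?_
    rcases hlt with hlt | ⟨rfl, hlt⟩
    · exact Or.inl hlt
    · have : z ≠ y := by rintro rfl; exact hcyT hxz
      omega
  · intro z l hz hl hzF hu
    rw [hwo l (by omega) (by omega)]
    exact h.fresh_ahead z l (by omega) hl hzF hu
  · intro z l hz hl hzF hu
    rcases Nat.lt_succ_iff_lt_or_eq.1 hz with hz | rfl
    · rw [hwo l (by omega) (by omega)]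
      exact h.fresh_passed z l hz hl hzF hu
    · obtain rfl : l = d + 1 := by omega
      rw [hwd']
      exact h.fresh_ahead z d le_rfl (by omega) hzF fun u hu' => hu u hu'.le
  · intro z l hz hzT hl
    obtain rfl : l = d := by omega
    rw [hwd]
    have : z ≠ y := by rintro rfl; exact hcyT hzT
    exact h.vertical z _ (by omega) hzT (by omega)
  · have waiting : ∀ l l', (l' = l ∧ l ≠ d ∧ l ≠ d + 1 ∨ l = d ∧ l' = d + 1) →
        Waiting H T c y l → Waiting H T c (y + 1) l' := by
      rintro l l' hl ⟨u, z, huT, hz⟩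
      have hne : z ≠ y ∨ u ≠ c := by
        by_contra! hcon
        exact hcyT (hcon.1 ▸ hcon.2 ▸ huT)
      exact ⟨u, z, huT, by omega⟩
    have not_waiting : ¬ Waiting H T c y (d + 1) := by
      rintro ⟨u, z, huT, hz⟩
      omega
    have live : ∀ l, l ≠ d → l ≠ d + 1 → Live H F T c (y + 1) l → Live H F T c y l :=
      fun l h₁ h₂ hl => ⟨hl.1, fun hlv => by omega⟩
    have above : Live H F T c (y + 1) d → ∃ z, y < z ∧ (c, z) ∈ T := by
      intro hl
      rcases hl.2 (by omega) with hl | ⟨z, hz, hzT⟩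
      · exact absurd (hF.closed hcy le_rfl (by omega) hl.1) hl.2
      · exact ⟨z, hz, hzT⟩
    have live_bot : Live H F T c (y + 1) d → Live H F T c y (d + 1) := by
      intro hl
      obtain ⟨z, hz, hzT⟩ := above hl
      exact ⟨by omega, fun _ => Or.inr ⟨z, hz.le, hzT⟩⟩
    have live_left : Live H F T c y d := ⟨by omega, fun hlv => by omega⟩
    intro l₁ l₂ hl h₁ h₂ hS₁ hS₂
    by_cases e₁ : l₁ = d
    · subst e₁
      by_cases e₂ : l₂ = l₁ + 1
      · subst e₂
        obtain ⟨z, hz, hzT⟩ := above h₁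
        rw [hwd'] at hS₂
        exact absurd hS₂ (hrow z hz hzT)
      · rw [hwo l₂ (by omega) e₂] at hS₂ ⊢
        rw [hwd] at hS₁ ⊢
        exact (h.order _ l₂ (by omega) (live_bot h₁) (live _ (by omega) e₂ h₂) hS₁ hS₂).imp_right
          fun h => ⟨h.1, waiting _ _ (by omega) h.2⟩
    by_cases e₁' : l₁ = d + 1
    · subst e₁'
      rw [hwo l₂ (by omega) (by omega)] at hS₂ ⊢
      rw [hwd'] at hS₁ ⊢
      exact (h.order _ l₂ (by omega) live_left (live _ (by omega) (by omega) h₂) hS₁ hS₂).imp_right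
        fun h => ⟨h.1, waiting _ _ (by omega) h.2⟩
    rw [hwo l₁ e₁ e₁'] at hS₁ ⊢
    have h₁' := live _ e₁ e₁' h₁
    by_cases e₂ : l₂ = d
    · subst e₂
      rw [hwd] at hS₂ ⊢
      exact (h.order l₁ _ (by omega) h₁' (live_bot h₂) hS₁ hS₂).imp_right
        fun h => absurd h.2 not_waiting
    by_cases e₂' : l₂ = d + 1
    · subst e₂'
      rw [hwd'] at hS₂ ⊢
      exact (h.order l₁ _ (by omega) h₁' live_left hS₁ hS₂).imp_right
        fun h => ⟨h.1, waiting _ _ (by omega) h.2⟩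
    rw [hwo l₂ e₂ e₂'] at hS₂ ⊢
    exact (h.order l₁ l₂ hl h₁' (live _ e₂ e₂' h₂) hS₁ hS₂).imp_right
      fun h => ⟨h.1, waiting _ _ (by omega) h.2⟩

/-- Supplies the value of a newly touched pipe: finitely many bounds leave an open gap. -/
theorem exists_value_between (f : ℕ → ℝ) (S : Finset ℕ) (P Q : ℕ → Prop)
    (h : ∀ p ∈ S, P p → ∀ q ∈ S, Q q → f q < f p) :
    ∃ b, (∀ p ∈ S, P p → b < f p) ∧ ∀ q ∈ S, Q q → f q < b := by
  classical
  obtain ⟨b, h₁, h₂⟩ := Order.exists_between_finsets ((S.filter Q).image f) ((S.filter P).image f)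
    (by
      simp only [Finset.mem_image, Finset.mem_filter]
      rintro _ ⟨q, ⟨hq, hQ⟩, rfl⟩ _ ⟨p, ⟨hp, hP⟩, rfl⟩
      exact h p hp hP q hq hQ)
  refine ⟨b, fun p hp hP => h₂ _ ?_, fun q hq hQ => h₁ _ ?_⟩
  · exact Finset.mem_image_of_mem f (Finset.mem_filter.2 ⟨hp, hP⟩)
  · exact Finset.mem_image_of_mem f (Finset.mem_filter.2 ⟨hq, hQ⟩)

/-- At an elbow, the invariant can be extended to the pipe that arrives from below. -/
theorem SweepState.touch_bottom (hF : CompatibleFilling H F T) {c y : ℕ} {f : ℕ → ℝ}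
    {S : Finset ℕ} (h : SweepState H F T M c y f S) (hcyT : (c, y) ∈ T) :
    ∃ f' S', SweepState H F T M c y f' S' ∧ bottomPipe H F T (c, y) ∈ S' := by
  by_cases hB : bottomPipe H F T (c, y) ∈ S
  · exact ⟨f, S, h, hB⟩
  have hcy := hF.subset hcyT
  have hy := hF.le_height hcy
  obtain ⟨e, he⟩ : ∃ e, e = c + (H - y) + 1 := ⟨_, rfl⟩
  have hBe : bottomPipe H F T (c, y) = sweepPerm H F T c y e := by simp [bottomPipe, he]
  rw [hBe] at hB ⊢
  set w := sweepPerm H F T c y with hwdef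
  -- A tie across level `e` would need a touched pipe waiting in a row `z < y`. A node of that row
  -- west of column `c` is incompatible with `(c, y)`, and one in column `c` would have touched the
  -- bottom pipe; so the waiting pipe is fresh, a contradiction.
  have hstrict : ∀ l₁ l₂, l₁ < e → e < l₂ → Live H F T c y l₁ → Live H F T c y l₂ →
      w l₁ ∈ S → w l₂ ∈ S → f (w l₂) < f (w l₁) := by
    intro l₁ l₂ hl₁ hl₂ h₁ h₂ hS₁ hS₂
    rcases h.order l₁ l₂ (by omega) h₁ h₂ hS₁ hS₂ with hlt | ⟨-, u, z, huT, hz⟩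
    · exact hlt
    exfalso
    have hcz : (c, z) ∈ F :=
      hF.closed (hF.subset huT) (by omega) le_rfl (hF.le_height (hF.subset huT))
    refine h.fresh_passed z l₂ (by omega) (by omega) hcz (fun u' hu' huT' => ?_) hS₂
    rcases hu'.lt_or_eq with hlt | rfl
    · exact hF.compatible huT' hcyT hlt (by omega) hcz
    · exact hB (h.vertical z e (by omega) huT' (by omega))
  obtain ⟨b, hbu, hbl⟩ := exists_value_between f S (fun p => ∃ l < e, Live H F T c y l ∧ w l = p)
    (fun p => ∃ l, e < l ∧ Live H F T c y l ∧ w l = p) (by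
      rintro _ hp ⟨l₁, hl₁, h₁, rfl⟩ _ hq ⟨l₂, hl₂, h₂, rfl⟩
      exact hstrict l₁ l₂ hl₁ hl₂ h₁ h₂ hp hq)
  have hf : ∀ p ∈ S, Function.update f (w e) b p = f p := by
    intro p hp
    rw [Function.update_of_ne]
    rintro rfl
    exact hB hp
  have hmem : ∀ l, l ≠ e → w l ∈ insert (w e) S → w l ∈ S := by
    intro l hl hS
    exact Finset.mem_of_mem_insert_of_ne hS (fun hh => hl (w.injective hh))
  refine ⟨Function.update f (w e) b, insert (w e) S, ⟨?_, ?_, ?_, ?_, ?_⟩,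
    Finset.mem_insert_self _ _⟩
  · intro x z hxz hlt
    obtain ⟨h₁, h₂, h₃⟩ := h.contact x z hxz hlt
    rw [hf _ h₁, hf _ h₂]
    exact ⟨Finset.mem_insert_of_mem h₁, Finset.mem_insert_of_mem h₂, h₃⟩
  · intro z l hz hl hzF hu hS
    exact h.fresh_ahead z l hz hl hzF hu (hmem l (by omega) hS)
  · intro z l hz hl hzF hu hS
    exact h.fresh_passed z l hz hl hzF hu (hmem l (by omega) hS)
  · intro z l hz hzT hl
    exact Finset.mem_insert_of_mem (h.vertical z l hz hzT hl)
  · intro l₁ l₂ hl h₁ h₂ hS₁ hS₂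
    by_cases e₁ : l₁ = e
    · subst e₁
      have hS₂ := hmem l₂ (by omega) hS₂
      left
      rw [← hwdef, hf _ hS₂, Function.update_self]
      exact hbl _ hS₂ ⟨l₂, hl, h₂, rfl⟩
    by_cases e₂ : l₂ = e
    · subst e₂
      have hS₁ := hmem l₁ (by omega) hS₁
      left
      rw [← hwdef, hf _ hS₁, Function.update_self]
      exact hbu _ hS₁ ⟨l₁, hl, h₁, rfl⟩
    have hS₁ := hmem l₁ e₁ hS₁
    have hS₂ := hmem l₂ e₂ hS₂
    rw [← hwdef, hf _ hS₁, hf _ hS₂]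
    exact h.order l₁ l₂ hl h₁ h₂ hS₁ hS₂

/-- The left pipe turns up and the bottom pipe turns right, so levels persist; only the value of an
untouched left pipe has to be chosen. -/
theorem SweepState.elbow_tile (hF : CompatibleFilling H F T)
    (hM : ∀ x y, (x, y) ∈ M → (∃ z, y < z ∧ (x, z) ∈ T) ∧ ∃ u, x < u ∧ (u, y) ∈ T)
    {c y : ℕ} {f : ℕ → ℝ} {S : Finset ℕ} (h : SweepState H F T M c y f S) (hcyT : (c, y) ∈ T) :
    ∃ f' S', SweepState H F T M c (y + 1) f' S' := by
  obtain ⟨f, S, h, hB⟩ := h.touch_bottom hF hcyT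
  have hcy := hF.subset hcyT
  have hy := hF.le_height hcy
  obtain ⟨d, hd⟩ : ∃ d, d = c + (H - y) := ⟨_, rfl⟩
  have hLd : leftPipe H F T (c, y) = sweepPerm H F T c y d := by simp [leftPipe, hd]
  have hBd : bottomPipe H F T (c, y) = sweepPerm H F T c y (d + 1) := by simp [bottomPipe, hd]
  have hw : sweepPerm H F T c (y + 1) = sweepPerm H F T c y := by
    simp [sweepPerm_succ, tilePerm, hcyT]
  rw [hBd] at hB
  set w := sweepPerm H F T c y with hwdef
  have hwinj : ∀ {l l'}, l ≠ l' → w l ≠ w l' := fun hl hh => hl (w.injective hh)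
  have hfresh : (∃ z, y < z ∧ (c, z) ∈ T) → w d ∉ S := by
    rintro ⟨z, hz, hzT⟩
    exact h.fresh_ahead y d le_rfl (by omega) hcy fun u hu huT =>
      hF.compatible huT hzT hu hz hcy
  have live_left : Live H F T c y d := ⟨by omega, fun hlv => by omega⟩
  have live_bot : Live H F T c y (d + 1) := ⟨by omega, fun _ => Or.inr ⟨y, le_rfl, hcyT⟩⟩
  have bot_strict : ∀ l, l < d + 1 → Live H F T c y l → w l ∈ S → f (w (d + 1)) < f (w l) := by
    intro l hl hlive hS
    rcases h.order l (d + 1) hl hlive live_bot hS hB with hlt | ⟨-, u, z, huT, hz⟩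
    · exact hlt
    · omega
  -- A touched left pipe keeps its value, and then the node is not in `M`. An untouched one copies
  -- the bottom value at a node of `M`, and otherwise goes strictly between it and the values at
  -- smaller live levels.
  obtain ⟨f', hf, hfM, hfnM, hfup⟩ : ∃ f' : ℕ → ℝ, (∀ p ∈ S, f' p = f p) ∧
      ((c, y) ∈ M → f' (w d) = f (w (d + 1))) ∧ ((c, y) ∉ M → f (w (d + 1)) < f' (w d)) ∧
      ((∃ z, y < z ∧ (c, z) ∈ T) → ∀ l < d, Live H F T c y l → w l ∈ S →
        f' (w d) < f (w l)) := by
    by_cases hL : w d ∈ S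
    · refine ⟨f, fun _ _ => rfl, fun hm => absurd hL (hfresh (hM c y hm).1),
        fun _ => bot_strict d (by omega) live_left hL, fun hz => absurd hL (hfresh hz)⟩
    have hupd : ∀ b, ∀ p ∈ S, Function.update f (w d) b p = f p := by
      intro b p hp
      rw [Function.update_of_ne]
      rintro rfl
      exact hL hp
    by_cases hm : (c, y) ∈ M
    · refine ⟨Function.update f (w d) (f (w (d + 1))), hupd _, fun _ => by simp,
        fun h => absurd hm h, fun _ l hl hlive hS => ?_⟩
      rw [Function.update_self]
      exact bot_strict l (by omega) hlive hS
    · obtain ⟨b, hbu, hbl⟩ := exists_value_between f S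
        (fun p => ∃ l < d, Live H F T c y l ∧ w l = p) (fun p => p = w (d + 1)) (by
          rintro _ hp ⟨l₁, hl₁, h₁, rfl⟩ _ hq rfl
          exact bot_strict l₁ (by omega) h₁ hp)
      refine ⟨Function.update f (w d) b, hupd _, fun h => absurd h hm, fun _ => ?_,
        fun _ l hl hlive hS => ?_⟩
      · rw [Function.update_self]
        exact hbl _ hB rfl
      · rw [Function.update_self]
        exact hbu _ hS ⟨l, hl, hlive, rfl⟩
  have hfle : f (w (d + 1)) ≤ f' (w d) := by
    by_cases hm : (c, y) ∈ M
    · exact (hfM hm).ge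
    · exact (hfnM hm).le
  have hmem : ∀ l, l ≠ d → w l ∈ insert (w d) S → w l ∈ S := fun l hl hS =>
    Finset.mem_of_mem_insert_of_ne hS (hwinj hl)
  refine ⟨f', insert (w d) S, ⟨?_, ?_, ?_, ?_, ?_⟩⟩
  · intro x z hxz hlt
    by_cases hnew : x = c ∧ z = y
    · obtain ⟨rfl, rfl⟩ := hnew
      rw [hLd, hBd, hf _ hB]
      exact ⟨Finset.mem_insert_self _ _, Finset.mem_insert_of_mem hB, hfM, hfnM⟩
    · obtain ⟨h₁, h₂, h₃⟩ := h.contact x z hxz (by omega)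
      rw [hf _ h₁, hf _ h₂]
      exact ⟨Finset.mem_insert_of_mem h₁, Finset.mem_insert_of_mem h₂, h₃⟩
  · intro z l hz hl hzF hu hS
    rw [hw] at hS
    exact h.fresh_ahead z l (by omega) hl hzF hu (hmem l (by omega) hS)
  · intro z l hz hl hzF hu hS
    rw [hw] at hS
    have hzy : z ≠ y := by
      rintro rfl
      exact hu c le_rfl hcyT
    exact h.fresh_passed z l (by omega) hl hzF hu (hmem l (by omega) hS)
  · intro z l hz hzT hl
    obtain rfl : l = d := by omega
    rw [hw]
    exact Finset.mem_insert_self _ _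
  · have live : ∀ l, Live H F T c (y + 1) l → Live H F T c y l :=
      fun l hl => ⟨hl.1, fun _ => Or.inr ⟨y, le_rfl, hcyT⟩⟩
    have above : Live H F T c (y + 1) d → ∃ z, y < z ∧ (c, z) ∈ T := by
      intro hl
      rcases hl.2 (by omega) with hl | ⟨z, hz, hzT⟩
      · exact absurd (hF.closed hcy le_rfl (by omega) hl.1) hl.2
      · exact ⟨z, hz, hzT⟩
    have waiting : ∀ l, l ≠ d → Waiting H T c y l → Waiting H T c (y + 1) l := by
      rintro l hl ⟨u, z, huT, hz⟩
      exact ⟨u, z, huT, by omega⟩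
    intro l₁ l₂ hl h₁ h₂ hS₁ hS₂
    rw [hw] at hS₁ hS₂ ⊢
    have h₁' := live _ h₁
    have h₂' := live _ h₂
    by_cases e₂ : l₂ = d
    · subst e₂
      have hS₁ := hmem l₁ hl.ne hS₁
      rw [hf _ hS₁]
      exact Or.inl (hfup (above h₂) l₁ hl h₁' hS₁)
    replace hS₂ := hmem l₂ e₂ hS₂
    rw [hf _ hS₂]
    by_cases e₁ : l₁ = d
    · subst e₁
      by_cases e₂' : l₂ = l₁ + 1
      · subst e₂'
        by_cases hm : (c, y) ∈ M
        · obtain ⟨u, hu, huT⟩ := (hM c y hm).2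
          exact Or.inr ⟨(hfM hm).symm, u, y, huT, by omega⟩
        · exact Or.inl (hfnM hm)
      -- Levels beyond `d + 1` are compared with the left pipe through the bottom pipe, whose value
      -- is at most that of the left pipe.
      · rcases h.order _ l₂ (by omega) live_bot h₂' hB hS₂ with hlt | ⟨heq, hwt⟩
        · exact Or.inl (hlt.trans_le hfle)
        · rcases hfle.lt_or_eq with hlt | heq'
          · exact Or.inl (heq.trans_lt hlt)
          · exact Or.inr ⟨heq.trans heq', waiting _ e₂ hwt⟩
    have hS₁ := hmem l₁ e₁ hS₁
    rw [hf _ hS₁]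
    exact (h.order l₁ l₂ hl h₁' h₂' hS₁ hS₂).imp_right fun h => ⟨h.1, waiting _ e₂ h.2⟩

theorem SweepState.exists_column (hF : CompatibleFilling H F T)
    (hM : ∀ x y, (x, y) ∈ M → (∃ z, y < z ∧ (x, z) ∈ T) ∧ ∃ u, x < u ∧ (u, y) ∈ T)
    {c : ℕ} (h : ∃ f S, SweepState H F T M c 0 f S) (y : ℕ) (hy : y ≤ H + 1) :
    ∃ f S, SweepState H F T M c y f S := by
  induction y with
  | zero => exact h
  | succ y ih =>
    obtain ⟨f, S, h⟩ := ih (by omega)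
    by_cases hcyT : (c, y) ∈ T
    · exact h.elbow_tile hF hM hcyT
    by_cases hcy : (c, y) ∈ F
    · exact ⟨f, S, h.crossing_tile hF hcy hcyT⟩
    · exact ⟨f, S, h.empty_tile hF (by omega) hcy⟩

theorem exists_sweepState (hF : CompatibleFilling H F T)
    (hM : ∀ x y, (x, y) ∈ M → (∃ z, y < z ∧ (x, z) ∈ T) ∧ ∃ u, x < u ∧ (u, y) ∈ T) (c : ℕ) :
    ∃ f S, SweepState H F T M c 0 f S := by
  induction c with
  | zero => exact ⟨0, ∅, .initial 0⟩
  | succ c ih =>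
    obtain ⟨f, S, h⟩ := SweepState.exists_column hF hM ih (H + 1) le_rfl
    exact ⟨f, S, h.next_column hF⟩

/-- The nodes in the first `c` columns admit a potential on the pipes which is constant along the
contacts in `M`, and for which the left pipe lies above the bottom pipe at all other contacts. -/
theorem exists_pipe_potential (hF : CompatibleFilling H F T)
    (hM : ∀ x y, (x, y) ∈ M → (∃ z, y < z ∧ (x, z) ∈ T) ∧ ∃ u, x < u ∧ (u, y) ∈ T) (c : ℕ) :
    ∃ f : ℕ → ℝ, ∀ x z, (x, z) ∈ T → x < c →
      ((x, z) ∈ M → f (leftPipe H F T (x, z)) = f (bottomPipe H F T (x, z))) ∧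
      ((x, z) ∉ M → f (bottomPipe H F T (x, z)) < f (leftPipe H F T (x, z))) := by
  obtain ⟨f, S, h⟩ := exists_sweepState hF hM c
  exact ⟨f, fun x z hT hx => (h.contact x z hT (Or.inl hx)).2.2⟩

end Sweep

/-! ### The Ferrers diagram as a compatible filling -/

theorem le_of_mem_visitedFrom {ν : LatticePath} {p v : ℕ × ℕ} (hv : v ∈ visitedFrom p ν) :
    p ≤ v := by
  induction ν generalizing p with
  | nil => simp_all [visitedFrom]
  | cons s ν ih =>
    cases s <;> simp only [visitedFrom, List.mem_cons] at hv <;> rcases hv with rfl | hv <;>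
      first
      | exact le_rfl
      | exact le_trans (by simp [Prod.le_def]) (ih hv)

/-- The path skips no column and never descends, so it meets an earlier column no higher than `v`.
This makes the diagram closed to the northwest. -/
theorem exists_mem_visitedFrom_fst_eq {ν : LatticePath} {p v : ℕ × ℕ}
    (hv : v ∈ visitedFrom p ν) {x : ℕ} (h₁ : p.1 ≤ x) (h₂ : x ≤ v.1) :
    ∃ u ∈ visitedFrom p ν, u.1 = x ∧ u.2 ≤ v.2 := by
  rcases h₁.eq_or_lt with rfl | hlt
  · refine ⟨p, ?_, rfl, (le_of_mem_visitedFrom hv).2⟩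
    cases ν with
    | nil => simp [visitedFrom]
    | cons s ν => cases s <;> simp [visitedFrom]
  induction ν generalizing p with
  | nil =>
    simp only [visitedFrom, List.mem_singleton] at hv
    subst hv
    omega
  | cons s ν ih =>
    cases s <;> simp only [visitedFrom, List.mem_cons] at hv ⊢ <;> rcases hv with rfl | hv
    · omega
    · obtain ⟨u, hu, h⟩ := ih hv h₁ hlt
      exact ⟨u, Or.inr hu, h⟩
    · omega
    · rcases (Nat.succ_le_of_lt hlt).eq_or_lt with rfl | hlt'
      · refine ⟨(p.1 + 1, p.2), Or.inr ?_, rfl, (le_of_mem_visitedFrom hv).2⟩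
        cases ν with
        | nil => simp [visitedFrom]
        | cons s ν => cases s <;> simp [visitedFrom]
      · obtain ⟨u, hu, h⟩ := ih hv hlt'.le hlt'
        exact ⟨u, Or.inr hu, h⟩

theorem mem_readingOrder_of_northwest {ν : LatticePath} {x y x' y' : ℕ}
    (h : (x, y) ∈ readingOrder ν) (hx : x' ≤ x) (hy : y ≤ y') (hy' : y' ≤ height ν) :
    (x', y') ∈ readingOrder ν := by
  rw [mem_readingOrder] at h ⊢
  obtain ⟨hw, -, v, hv, hvx, hvy⟩ := h
  obtain ⟨u, hu, hux, huy⟩ := exists_mem_visitedFrom_fst_eq hv (Nat.zero_le x')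
    (by simp only at hvx; omega)
  simp only at hvx hvy hw ⊢
  exact ⟨by omega, hy', u, hu, hux, by simp only; omega⟩

/-- The lattice points underlying a set of points of `A_ν`. -/
def latticePoints {ν : LatticePath} (T : Finset (Pt ν)) : Set (ℕ × ℕ) :=
  {p | ∃ h : p ∈ readingOrder ν, (⟨p, h⟩ : Pt ν) ∈ T}

theorem val_mem_latticePoints {ν : LatticePath} {T : Finset (Pt ν)} {p : Pt ν} :
    p.1 ∈ latticePoints T ↔ p ∈ T :=
  ⟨fun h => h.2, fun h => ⟨p.2, h⟩⟩

/-- By northwest closure, a rectangle lies in the diagram as soon as its southeast corner does. -/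
theorem compatibleFilling_latticePoints {ν : LatticePath} {T : Finset (Pt ν)}
    (hT : ∀ p ∈ T, ∀ q ∈ T, ¬ Incompatible p q) :
    CompatibleFilling (height ν) {p | p ∈ readingOrder ν} (latticePoints T) where
  closed h hx hy hy' := mem_readingOrder_of_northwest h hx hy hy'
  le_height h := ((mem_readingOrder _ _).1 h).2.1
  subset h := h.1
  compatible := by
    rintro x₁ y₁ x₂ y₂ ⟨h₁, hT₁⟩ ⟨h₂, hT₂⟩ hx hy hcorner
    refine hT _ hT₁ _ hT₂ (Or.inl ⟨⟨hx, hy⟩, ?_⟩)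
    rintro ⟨x, y⟩ ⟨-, hy₁⟩ ⟨hx₂, hy₂⟩
    exact mem_readingOrder_of_northwest hcorner hx₂ hy₁
      (le_trans hy₂ ((mem_readingOrder _ _).1 h₂).2.1)

/-! ### The word `Q_ν` as a sweep -/

theorem filter_lt_finRange {m : ℕ} (k : Fin m) :
    (List.finRange m).filter (fun j => j < k) = (List.finRange m).take k := by
  conv_lhs => rw [← List.take_append_drop (k : ℕ) (List.finRange m), List.filter_append]
  rw [List.filter_eq_self.2, List.filter_eq_nil_iff.2, List.append_nil]
  · intro j hj
    obtain ⟨i, hi, rfl⟩ := List.mem_drop_iff_getElem.1 hj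
    simp [Fin.lt_def]
  · intro j hj
    obtain ⟨i, hi, rfl⟩ := List.mem_take_iff_getElem.1 hj
    simp only [List.getElem_finRange, Fin.lt_def, decide_eq_true_eq, Fin.val_cast]
    omega

theorem prod_map_filter {ι G : Type*} [Monoid G] (l : List ι) (P : ι → Prop) [DecidablePred P]
    (g : ι → G) :
    ((l.filter P).map g).prod = (l.map (fun j => if P j then g j else 1)).prod := by
  induction l with
  | nil => rfl
  | cons a l ih =>
    by_cases h : P a <;> simp [h, ih]

theorem readingOrder_eq_append {ν : LatticePath} (p : ℕ × ℕ) (hp : p ∈ readingOrder ν) :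
    ∃ l, readingOrder ν =
      ((List.product (List.range p.1) (List.range (height ν + 1))) ++
        (List.range p.2).map (fun z => (p.1, z))).filter (fun p => WeaklyAbove ν p) ++ p :: l := by
  obtain ⟨x, y⟩ := p
  obtain ⟨hx, hy, hab⟩ := (mem_readingOrder _ _).1 hp
  have split : ∀ a b : ℕ, a ≤ b → ∃ l, List.range (b + 1) = List.range a ++ a :: l := by
    intro a b hab
    obtain ⟨k, rfl⟩ := Nat.exists_eq_add_of_le hab
    refine ⟨(List.range k).map (fun i => a + (i + 1)), ?_⟩
    rw [add_assoc, List.range_add, List.range_succ_eq_map]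
    simp [Function.comp_def]
  obtain ⟨lx, hlx⟩ := split x _ hx
  obtain ⟨ly, hly⟩ := split y _ hy
  refine ⟨(ly.map (fun z => (x, z)) ++ List.product lx (List.range (height ν + 1))).filter
    (fun p => WeaklyAbove ν p), ?_⟩
  rw [readingOrder, hlx]
  have : List.product (List.range x ++ x :: lx) (List.range (height ν + 1)) =
      (List.product (List.range x) (List.range (height ν + 1)) ++
        (List.range y).map (fun z => (x, z))) ++ (x, y) :: (ly.map (fun z => (x, z)) ++
          List.product lx (List.range (height ν + 1))) := by
    simp only [List.product, List.flatMap_append, List.flatMap_cons]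
    conv_lhs => enter [2, 1]; rw [hly]
    simp
  rw [this, List.filter_append, List.filter_cons_of_pos (by simpa using hab)]

theorem nodup_readingOrder (ν : LatticePath) : (readingOrder ν).Nodup :=
  (List.nodup_range.product List.nodup_range).filter _

theorem take_position {ν : LatticePath} (p : Pt ν) :
    (readingOrder ν).take (position p) =
      ((List.product (List.range p.1.1) (List.range (height ν + 1))) ++
        (List.range p.1.2).map (fun z => (p.1.1, z))).filter (fun p => WeaklyAbove ν p) := by
  obtain ⟨p, hp⟩ := p
  obtain ⟨l, hl⟩ := readingOrder_eq_append p hp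
  have hnd := nodup_readingOrder ν
  change (readingOrder ν).take ((readingOrder ν).idxOf p) =
    ((List.product (List.range p.1) (List.range (height ν + 1))) ++
      (List.range p.2).map (fun z => (p.1, z))).filter (fun p => WeaklyAbove ν p)
  rw [hl] at hnd ⊢
  have hnot := (List.nodup_append.1 hnd).2.2
  rw [List.idxOf_append_of_notMem (fun h => hnot _ h _ List.mem_cons_self rfl),
    List.idxOf_cons_self, add_zero, List.take_left]

theorem prod_map_tilePerm_take {ν : LatticePath} (T : Set (ℕ × ℕ)) (p : Pt ν) :
    (((readingOrder ν).take (position p)).map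
      (tilePerm (height ν) {p | p ∈ readingOrder ν} T)).prod =
      sweepPerm (height ν) {p | p ∈ readingOrder ν} T p.1.1 p.1.2 := by
  rw [take_position, prod_map_filter]
  -- Points below the path carry the identity tile, so the sweep may run over the whole rectangle.
  have : ∀ q ∈ List.product (List.range p.1.1) (List.range (height ν + 1)) ++
        (List.range p.1.2).map (fun z => (p.1.1, z)),
      (if WeaklyAbove ν q then tilePerm (height ν) {p | p ∈ readingOrder ν} T q else 1) =
        tilePerm (height ν) {p | p ∈ readingOrder ν} T q := by
    intro q _
    split_ifs with h
    · rfl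
    · rw [tilePerm, if_neg]
      exact fun hq => h ((mem_readingOrder _ _).1 hq.1).2.2
  rw [List.map_congr_left this, List.map_append, List.prod_append, sweepPerm]
  congr 1
  · simp only [List.product, List.flatMap_def, List.map_flatten, List.prod_flatten, List.map_map]
    simp only [Function.comp_def, List.map_map]
  · rw [List.map_map]
    rfl

/-- Levels of the symmetric group on `n + 1` letters are identified with natural numbers. -/
theorem val_prod_word {ν : LatticePath} (n : ℕ) (hn : ∀ p : Pt ν, dist p < n)
    (T : Finset (Pt ν)) (t : Pt ν) (i : Fin (n + 1)) :
    (((((List.finRange _).filter (fun j => j < position t ∧ j ∉ positions T)).map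
      (fun j => simpleTransposition (word ν n hn j))).prod i : Fin (n + 1)) : ℕ) =
      sweepPerm (height ν) {p | p ∈ readingOrder ν} (latticePoints T) t.1.1 t.1.2 i := by
  have hfilter : (List.finRange (readingOrder ν).length).filter
      (fun j => j < position t ∧ j ∉ positions T) =
      ((List.finRange (readingOrder ν).length).take (position t)).filter
        (fun j => j ∉ positions T) := by
    rw [← filter_lt_finRange, List.filter_filter]
    congr 1
    funext j
    simp [Bool.and_comm]
  rw [hfilter, prod_map_filter, ← prod_map_tilePerm_take]
  have htake : (readingOrder ν).take (position t) =
      ((List.finRange (readingOrder ν).length).take (position t)).map (readingOrder ν).get := by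
    rw [List.map_take, List.map_get_finRange]
  rw [htake, List.map_map]
  generalize (List.finRange (readingOrder ν).length).take (position t) = l
  have hletter : ∀ (j : Fin (readingOrder ν).length) (i : Fin (n + 1)),
      (((if j ∉ positions T then simpleTransposition (word ν n hn j) else 1) i : Fin (n + 1)) : ℕ)
        = tilePerm (height ν) {p | p ∈ readingOrder ν} (latticePoints T)
          ((readingOrder ν).get j) i := by
    intro j i
    have hj : (readingOrder ν).get j ∈ latticePoints T ↔ j ∈ positions T := by
      rw [positions, Finset.mem_filter]
      simp only [Finset.mem_univ, true_and]
      exact val_mem_latticePoints (p := pointAt j)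
    rw [tilePerm]
    by_cases h : j ∈ positions T
    · rw [if_neg (by simpa using h), if_neg (fun hh => hh.2 (hj.2 h))]
      rfl
    · rw [if_pos h, if_pos ⟨List.get_mem _ _, fun hh => h (hj.1 hh)⟩]
      simp only [simpleTransposition, Equiv.swap_apply_def]
      have hd : ((word ν n hn j : Fin n) : ℕ) = ((readingOrder ν).get j).1 +
        (height ν - ((readingOrder ν).get j).2) := rfl
      rw [← hd]
      split_ifs <;> simp_all [Fin.ext_iff]
  induction l generalizing i with
  | nil => rfl
  | cons j l ih =>
    rw [List.map_cons, List.prod_cons, List.map_cons, List.prod_cons, Equiv.Perm.mul_apply,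
      Equiv.Perm.mul_apply, hletter, ih, Function.comp_apply]

/-! ### Roots and the marked cone -/

theorem permAct_simpleRoot {n : ℕ} (w : Equiv.Perm (Fin (n + 1))) (p : Fin n) :
    permAct w (simpleRoot p) = Pi.single (w p.castSucc) 1 - Pi.single (w p.succ) 1 := by
  funext i
  have h : ∀ j : Fin (n + 1), (Pi.single j (1 : ℝ) : Fin (n + 1) → ℝ) (w⁻¹ i) =
      (Pi.single (w j) (1 : ℝ) : Fin (n + 1) → ℝ) i := by
    intro j
    simp only [Pi.single_apply, Equiv.Perm.inv_eq_iff_eq]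
  simp only [permAct, simpleRoot, Pi.sub_apply, h]

theorem dotProduct_nodeRoot {ν : LatticePath} (n : ℕ) (hn : ∀ p : Pt ν, dist p < n)
    (T : Finset (Pt ν)) (t : Pt ν) (f : ℕ → ℝ) :
    (fun i : Fin (n + 1) => f i) ⬝ᵥ nodeRoot n hn T t =
      f (leftPipe (height ν) {p | p ∈ readingOrder ν} (latticePoints T) t.1) -
      f (bottomPipe (height ν) {p | p ∈ readingOrder ν} (latticePoints T) t.1) := by
  have hd : ((word ν n hn (position t) : Fin n) : ℕ) = t.1.1 + (height ν - t.1.2) := by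
    simp [word, pointAt_position, dist]
  rw [nodeRoot, rootFunction, permAct_simpleRoot, dotProduct_sub, dotProduct_single,
    dotProduct_single, val_prod_word, val_prod_word]
  simp [leftPipe, bottomPipe, hd]

theorem const_dotProduct_nodeRoot {ν : LatticePath} (n : ℕ) (hn : ∀ p : Pt ν, dist p < n)
    (T : Finset (Pt ν)) (t : Pt ν) (c : ℝ) :
    (fun _ : Fin (n + 1) => c) ⬝ᵥ nodeRoot n hn T t = 0 := by
  rw [dotProduct_nodeRoot n hn T t (fun _ => c), sub_self]

theorem markedCone_nonempty {ν : LatticePath} (n : ℕ) (hn : ∀ p : Pt ν, dist p < n)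
    {T A : Finset (Pt ν)} (hT : ∀ p ∈ T, ∀ q ∈ T, ¬ Incompatible p q)
    (hA : ∀ a ∈ A, IsAscent T a) : (markedCone n hn T A).Nonempty := by
  obtain ⟨f, hf⟩ := exists_pipe_potential (M := latticePoints A)
    (compatibleFilling_latticePoints hT) (by
      rintro x y ⟨h, hAx⟩
      obtain ⟨-, ⟨p, hp, hpx, hpy⟩, ⟨r, hr, hry, hrx⟩⟩ := hA _ hAx
      refine ⟨⟨p.1.2, hpy, ?_⟩, ⟨r.1.1, hrx, ?_⟩⟩
      · rw [← show p.1.1 = x from hpx]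
        exact val_mem_latticePoints.2 hp
      · rw [← show r.1.2 = y from hry]
        exact val_mem_latticePoints.2 hr) (width ν + 1)
  have key : ∀ t ∈ T, (t ∈ A → (fun i : Fin (n + 1) => f i) ⬝ᵥ nodeRoot n hn T t = 0) ∧
      (t ∉ A → 0 < (fun i : Fin (n + 1) => f i) ⬝ᵥ nodeRoot n hn T t) := by
    intro t ht
    have htw : t.1.1 < width ν + 1 := Nat.lt_succ_of_le ((mem_readingOrder _ _).1 t.2).1
    obtain ⟨h₁, h₂⟩ := hf t.1.1 t.1.2 (val_mem_latticePoints.2 ht) htw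
    rw [dotProduct_nodeRoot]
    exact ⟨fun h => sub_eq_zero.2 (h₁ (val_mem_latticePoints.2 h)),
      fun h => sub_pos.2 (h₂ (fun h' => h (val_mem_latticePoints.1 h')))⟩
  -- Roots are differences of unit vectors, so constant vectors pair to zero with them. Subtracting
  -- the mean moves the potential into `V` without changing any pairing.
  obtain ⟨c, hc⟩ : ∃ c : ℝ, ∑ i : Fin (n + 1), (f i - c) = 0 := by
    refine ⟨(∑ i : Fin (n + 1), f i) / (n + 1), ?_⟩
    rw [Finset.sum_sub_distrib, Finset.sum_const, Finset.card_univ, Fintype.card_fin,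
      nsmul_eq_mul]
    push_cast
    rw [mul_div_cancel₀ _ (by positivity), sub_self]
  have hsub : ∀ t, (fun i : Fin (n + 1) => f i - c) ⬝ᵥ nodeRoot n hn T t =
      (fun i : Fin (n + 1) => f i) ⬝ᵥ nodeRoot n hn T t := by
    intro t
    have := sub_dotProduct (fun i : Fin (n + 1) => f i) (fun _ => c) (nodeRoot n hn T t)
    rw [const_dotProduct_nodeRoot, sub_zero] at this
    exact this
  refine ⟨fun i => f i - c, hc, fun t ht => ?_, fun t ht => ?_⟩
  · rw [hsub]
    obtain ⟨htT, htA⟩ := Finset.mem_sdiff.1 ht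
    exact (key t htT).2 htA
  · rw [hsub]
    exact (key t (hA t ht).1).1 ht

end NuTamari

theorem mainTheorem9 (ν : NuTamari.LatticePath) (n : ℕ)
    (hn : ∀ p : NuTamari.Pt ν, NuTamari.dist p < n)
    (T A : Finset (NuTamari.Pt ν)) (hT : NuTamari.IsNuTree T)
    (hA : ∀ a ∈ A, NuTamari.IsAscent T a) :
    (∃ f : (Fin (n + 1) → ℝ) →ₗ[ℝ] ℝ,
      (∀ a ∈ A, f (NuTamari.nodeRoot n hn T a) = 0) ∧
      (∀ t ∈ T \ A, 0 < f (NuTamari.nodeRoot n hn T t))) ∧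
    (NuTamari.markedCone n hn T A).Nonempty := by
  obtain ⟨x, hx⟩ := NuTamari.markedCone_nonempty n hn hT.1 hA
  exact ⟨⟨dotProductBilin ℝ ℝ x, hx.2.2, hx.2.1⟩, x, hx⟩
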